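/- For a Borel probability measure $\mu$ on $\mathbb{R}^d$, let $C_p(\mu)\in[0,\infty]$ be its Poincaré constant, i.e. the smallest $C$ such that $$\operatorname{Var}_\mu(f)\le C\int_{\mathbb{R}^d}|\nabla f|^2\,d\mu$$ for all locally Lipschitz $f:\mathbb{R}^d\to\mathbb{R}$ that are differentiable $\mu$-almost everywhere (if $\mu$ is absolutely continuous with respect to Lebesgue measure these are all locally Lipschitz functions), with $C_p(\mu)=\infty$ if no finite $C$ exists. Let $$\sigma^2(\mu)=\sup_{|\alpha|=1}\operatorname{Var}_\mu(x\mapsto\alpha\cdot x)$$ be the largest directional variance. **Theorem.** Let $\mu,\nu$ be Borel probability measures on $\mathbb{R}^d$ with $C_p(\mu)<\infty$ and $C_p(\nu)<\infty$, let $\mu\star\nu$ be their convolution, and put $\sigma^2=\sigma^2(\mu\star\nu)$. Then $C_p(\mu\star\nu)<\infty$, $\sigma^2<\infty$, and $$C_p(\mu\star\nu)\le C_p(\mu)+C_p(\nu)-\frac{C_p(\mu)\,C_p(\nu)}{C_p(\mu)+C_p(\nu)}\cdot\frac{\big(C_p(\mu\star\nu)-\sigma^2\big)^2}{\big(C_p(\mu\star\nu)-\sigma^2\big)^2+C_p(\mu\star\nu)\,\sigma^2},$$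 where $0/0$ is read as $0$ (this occurs only if $\mu$ and $\nu$ are both point masses). -/

import Mathlib

open MeasureTheory ProbabilityTheory
open scoped ENNReal Gradient InnerProductSpace

/-- The measure `μ` on `ℝ^d` satisfies a Poincaré inequality with constant `C`:
`Var_μ(f) ≤ C ∫ |∇f|² dμ` for all locally Lipschitz `f` whose usual (Fréchet) gradient exists
`μ`-almost everywhere, so that the right-hand side is meaningful. By Rademacher's theorem these
are all locally Lipschitz functions whenever `μ` is absolutely continuous with respect to Lebesgue
measure. Both sides are computed in `[0, ∞]`; the variance is `∞` if `f` is not square-integrable. -/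
def SatisfiesPoincare {d : ℕ} (μ : Measure (EuclideanSpace ℝ (Fin d))) (C : ℝ≥0∞) : Prop :=
  ∀ f : EuclideanSpace ℝ (Fin d) → ℝ, LocallyLipschitz f →
    (∀ᵐ x ∂μ, DifferentiableAt ℝ f x) →
      evariance f μ ≤ C * ∫⁻ x, ‖∇ f x‖ₑ ^ 2 ∂μ

/-- The Poincaré constant `C_p(μ) ∈ [0, ∞]`: the smallest constant in the Poincaré inequality
(`∞` if there is no finite one). -/
noncomputable def poincareConst {d : ℕ} (μ : Measure (EuclideanSpace ℝ (Fin d))) : ℝ≥0∞ :=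
  sInf {C : ℝ≥0∞ | SatisfiesPoincare μ C}

/-- The largest directional variance `σ²(μ) ∈ [0, ∞]`, i.e. the supremum over unit vectors `α`
of the variance of `x ↦ α · x` under `μ`. -/
noncomputable def maxDirVariance {d : ℕ} (μ : Measure (EuclideanSpace ℝ (Fin d))) : ℝ≥0∞ :=
  ⨆ α ∈ Metric.sphere (0 : EuclideanSpace ℝ (Fin d)) 1, evariance (fun x => ⟪α, x⟫_ℝ) μ

/-! Write a, b, C for the Poincaré constants of μ, ν and μ ∗ ν, with X ~ μ and Y ~ ν independent.
Conditioning on Y splits the variance of f(X+Y) and yields Var f ≤ a E|∇f|² + b E|E[∇f | Y]|²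
(`variance_conv_le`). Conditioning on X gives the same bound with the roles exchanged. Weighting the
two by a and b makes both conditional terms carry ab, and Efron–Stein for the vector ∇f(X+Y)
(`efronStein_two`) bounds their sum by E|∇f|² + |E∇f|². Hence Var f ≤ (a+b) E|∇f|² − ab/(a+b) ·
(E|∇f|² − |E∇f|²) (`variance_conv_le_sub`).

The gain is lost only if ∇f is nearly constant. For a near-extremal f this is excluded by perturbing
f along the linear function with slope v = E∇f: Cauchy–Schwarz for the variance and for the Poincaré
deficit gives |E∇f|² ≤ (σ²/C + o(1)) E|∇f|² (`norm_integral_gradient_sq_le`). In the limit C ≤ a + b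
− ab/(a+b) · (1 − σ²/C), which is stronger than the claim by `sq_div_le_one_sub_div`. Near-extremals
may be taken bounded and Lipschitz, by truncation. -/

/-! ### Second moments of Hilbert-valued functions and Efron–Stein. -/

section HilbertValued

variable {α β F : Type*} [MeasurableSpace α] [MeasurableSpace β]
  [NormedAddCommGroup F]

theorem integrable_norm_sq_of_memLp {μ : Measure α} {U : α → F} (hU : MemLp U 2 μ) :
    Integrable (fun x => ‖U x‖ ^ 2) μ :=
  hU.integrable_norm_pow two_ne_zero

variable [InnerProductSpace ℝ F] [CompleteSpace F]

theorem integral_norm_sub_const_sq {μ : Measure α} [IsProbabilityMeasure μ] {U : α → F}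
    (hU : MemLp U 2 μ) (c : F) :
    ∫ x, ‖U x - c‖ ^ 2 ∂μ = ∫ x, ‖U x‖ ^ 2 ∂μ - 2 * ⟪c, ∫ x, U x ∂μ⟫_ℝ + ‖c‖ ^ 2 := by
  have hi : Integrable U μ := hU.integrable one_le_two
  have h1 := integrable_norm_sq_of_memLp hU
  have h2 : Integrable (fun x => 2 * ⟪c, U x⟫_ℝ) μ := (hi.const_inner c).const_mul 2
  have : ∀ x, ‖U x - c‖ ^ 2 = ‖U x‖ ^ 2 - 2 * ⟪c, U x⟫_ℝ + ‖c‖ ^ 2 := fun x => by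
    rw [norm_sub_sq_real, real_inner_comm]
  simp_rw [this]
  have h3 : Integrable (fun x => ‖U x‖ ^ 2 - 2 * ⟪c, U x⟫_ℝ) μ := h1.sub h2
  rw [integral_add h3 (integrable_const _), integral_sub h1 h2, integral_const_mul,
    integral_inner hi]
  simp

theorem integral_norm_sub_integral_sq {μ : Measure α} [IsProbabilityMeasure μ] {U : α → F}
    (hU : MemLp U 2 μ) :
    ∫ x, ‖U x - ∫ x', U x' ∂μ‖ ^ 2 ∂μ = ∫ x, ‖U x‖ ^ 2 ∂μ - ‖∫ x, U x ∂μ‖ ^ 2 := by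
  rw [integral_norm_sub_const_sq hU, real_inner_self_eq_norm_sq]
  ring

theorem norm_integral_sq_le {μ : Measure α} [IsProbabilityMeasure μ] {U : α → F}
    (hU : MemLp U 2 μ) : ‖∫ x, U x ∂μ‖ ^ 2 ≤ ∫ x, ‖U x‖ ^ 2 ∂μ := by
  have h := integral_norm_sub_integral_sq hU
  have : 0 ≤ ∫ x, ‖U x - ∫ x', U x' ∂μ‖ ^ 2 ∂μ := integral_nonneg fun _ => by positivity
  linarith

/-- The Efron–Stein inequality for a bounded vector-valued function of two independent
variables. -/
theorem efronStein_two {μ : Measure α} {ν : Measure β} [IsProbabilityMeasure μ]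
    [IsProbabilityMeasure ν] {W : α × β → F} (hW : StronglyMeasurable W) {K : ℝ}
    (hK : ∀ z, ‖W z‖ ≤ K) :
    ∫ x, ‖∫ y, W (x, y) ∂ν‖ ^ 2 ∂μ + ∫ y, ‖∫ x, W (x, y) ∂μ‖ ^ 2 ∂ν ≤
      ∫ z, ‖W z‖ ^ 2 ∂(μ.prod ν) + ‖∫ z, W z ∂(μ.prod ν)‖ ^ 2 := by
  have hWL : MemLp W 2 (μ.prod ν) :=
    MemLp.of_bound hW.aestronglyMeasurable K (.of_forall hK)
  have hWi : Integrable W (μ.prod ν) := hWL.integrable one_le_two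
  have hKx : ∀ x, ‖∫ y, W (x, y) ∂ν‖ ≤ K := fun x => by
    simpa using norm_integral_le_of_norm_le_const (μ := ν) (.of_forall fun y => hK (x, y))
  have hKy : ∀ y, ‖∫ x, W (x, y) ∂μ‖ ≤ K := fun y => by
    simpa using norm_integral_le_of_norm_le_const (μ := μ) (.of_forall fun x => hK (x, y))
  have hb : StronglyMeasurable fun x => ∫ y, W (x, y) ∂ν := hW.integral_prod_right'
  have ha : StronglyMeasurable fun y => ∫ x, W (x, y) ∂μ := hW.integral_prod_left'
  have hbL : MemLp (fun x => ∫ y, W (x, y) ∂ν) 2 μ :=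
    MemLp.of_bound hb.aestronglyMeasurable K (.of_forall hKx)
  have haL : MemLp (fun y => ∫ x, W (x, y) ∂μ) 2 ν :=
    MemLp.of_bound ha.aestronglyMeasurable K (.of_forall hKy)
  have hD : StronglyMeasurable fun z : α × β => W z - ∫ x, W (x, z.2) ∂μ :=
    hW.sub (ha.comp_measurable measurable_snd)
  have hDL : MemLp (fun z : α × β => W z - ∫ x, W (x, z.2) ∂μ) 2 (μ.prod ν) :=
    MemLp.of_bound hD.aestronglyMeasurable (K + K) (.of_forall fun z =>
      (norm_sub_le _ _).trans (add_le_add (hK z) (hKy z.2)))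
  have hm : ∫ z, W z ∂(μ.prod ν) = ∫ x, ∫ y, W (x, y) ∂ν ∂μ := integral_prod _ hWi
  have hm' : ∫ z, W z ∂(μ.prod ν) = ∫ y, ∫ x, W (x, y) ∂μ ∂ν := integral_prod_symm _ hWi
  have e1 := integral_norm_sub_integral_sq hbL
  rw [← hm] at e1
  -- The left integrand is the squared norm of the ν-average of W(x, y) − ∫ W(·, y) dμ, so Jensen
  -- applies for each x.
  have e2 : ∫ x, ‖(∫ y, W (x, y) ∂ν) - ∫ z, W z ∂(μ.prod ν)‖ ^ 2 ∂μ ≤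
      ∫ x, ∫ y, ‖W (x, y) - ∫ x', W (x', y) ∂μ‖ ^ 2 ∂ν ∂μ := by
    refine integral_mono_of_nonneg (.of_forall fun _ => by positivity)
      (integrable_norm_sq_of_memLp hDL).integral_prod_left (.of_forall fun x => ?_)
    have hWx : MemLp (fun y => W (x, y)) 2 ν :=
      MemLp.of_bound (hW.comp_measurable measurable_prodMk_left).aestronglyMeasurable K
        (.of_forall fun y => hK (x, y))
    have h := norm_integral_sq_le (hWx.sub haL)
    simp only [Pi.sub_apply] at h
    rwa [integral_sub (hWx.integrable one_le_two) (haL.integrable one_le_two), ← hm'] at h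
  rw [← integral_prod _ (integrable_norm_sq_of_memLp hDL),
    integral_prod_symm _ (integrable_norm_sq_of_memLp hDL)] at e2
  have e3 : ∫ y, ∫ x, ‖W (x, y) - ∫ x', W (x', y) ∂μ‖ ^ 2 ∂μ ∂ν =
      ∫ z, ‖W z‖ ^ 2 ∂(μ.prod ν) - ∫ y, ‖∫ x, W (x, y) ∂μ‖ ^ 2 ∂ν := by
    rw [integral_prod_symm _ (integrable_norm_sq_of_memLp hWL),
      ← integral_sub (integrable_norm_sq_of_memLp hWL).integral_prod_right
        (integrable_norm_sq_of_memLp haL)]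
    refine integral_congr_ae (.of_forall fun y => ?_)
    exact integral_norm_sub_integral_sq (MemLp.of_bound
      (hW.comp_measurable measurable_prodMk_right).aestronglyMeasurable K
        (.of_forall fun x => hK (x, y)))
  simp only at e2
  linarith

end HilbertValued

/-! ### Extended variance and its lower semicontinuity. -/

section EVariance

variable {α : Type*} [MeasurableSpace α]

theorem lintegral_enorm_sub_const_sq {μ : Measure α} [IsProbabilityMeasure μ] {f : α → ℝ}
    (hf : MemLp f 2 μ) (c : ℝ) :
    ∫⁻ x, ‖f x - c‖ₑ ^ 2 ∂μ = evariance f μ + ‖c - ∫ x, f x ∂μ‖ₑ ^ 2 := by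
  have key : ∀ c : ℝ, ∫⁻ x, ‖f x - c‖ₑ ^ 2 ∂μ = ENNReal.ofReal (∫ x, ‖f x - c‖ ^ 2 ∂μ) := by
    intro c
    have hi : Integrable (fun x => ‖f x - c‖ ^ 2) μ :=
      integrable_norm_sq_of_memLp (hf.sub (memLp_const c))
    rw [ofReal_integral_eq_lintegral_ofReal hi (.of_forall fun _ => by positivity)]
    refine lintegral_congr fun x => ?_
    rw [ENNReal.ofReal_pow (norm_nonneg _), ofReal_norm]
  rw [evariance, key, key, ← ofReal_norm, ← ENNReal.ofReal_pow (norm_nonneg _),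
    ← ENNReal.ofReal_add (integral_nonneg fun _ => by positivity) (by positivity),
    integral_norm_sub_integral_sq hf, integral_norm_sub_const_sq hf]
  congr 1
  simp only [Real.norm_eq_abs, sq_abs, RCLike.inner_apply, conj_trivial]
  ring

/-- Removes the mean from the variance, so that Fatou applies with no integrability assumption. If
the double integral is finite, some f − f(x) is in L², hence so is f. -/
theorem two_mul_evariance_eq_lintegral_lintegral {μ : Measure α} [IsProbabilityMeasure μ]
    {f : α → ℝ} (hf : Measurable f) :
    2 * evariance f μ = ∫⁻ x, ∫⁻ y, ‖f y - f x‖ₑ ^ 2 ∂μ ∂μ := by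
  by_cases h : MemLp f 2 μ
  · simp_rw [lintegral_enorm_sub_const_sq h]
    rw [lintegral_add_left measurable_const, lintegral_const, measure_univ, mul_one, two_mul]
    rfl
  · rw [evariance_eq_top hf.aestronglyMeasurable h, ENNReal.mul_top two_ne_zero]
    by_contra hne
    have hm : Measurable fun x => ∫⁻ y, ‖f y - f x‖ₑ ^ 2 ∂μ :=
      Measurable.lintegral_prod_right' (f := fun p : α × α => ‖f p.2 - f p.1‖ₑ ^ 2) (by fun_prop)
    obtain ⟨x, hx⟩ := (ae_lt_top hm (Ne.symm hne)).exists
    refine h ?_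
    have : MemLp (fun y => f y - f x) 2 μ := by
      refine ⟨by fun_prop, ?_⟩
      rw [eLpNorm_lt_top_iff_lintegral_rpow_enorm_lt_top two_ne_zero ENNReal.ofNat_ne_top]
      simpa using hx
    have h' := this.add (memLp_const (f x))
    have he : (fun y => f y - f x) + (fun _ => f x) = f := by ext y; simp
    rwa [he] at h'

/-- Lower semicontinuity of the variance under pointwise convergence. -/
theorem evariance_le_liminf {μ : Measure α} [IsProbabilityMeasure μ] {f : α → ℝ}
    {u : ℕ → α → ℝ} (hu : ∀ n, Measurable (u n)) (hf : Measurable f)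
    (h : ∀ x, Filter.Tendsto (fun n => u n x) Filter.atTop (nhds (f x))) :
    evariance f μ ≤ Filter.liminf (fun n => evariance (u n) μ) Filter.atTop := by
  have h2 : ∀ {X : α → ℝ}, Measurable X →
      evariance X μ = ∫⁻ z, 2⁻¹ * ‖X z.2 - X z.1‖ₑ ^ 2 ∂(μ.prod μ) := by
    intro X hX
    rw [lintegral_const_mul _ (by fun_prop), lintegral_prod _ (by fun_prop),
      ← two_mul_evariance_eq_lintegral_lintegral hX, ← mul_assoc,
      ENNReal.inv_mul_cancel two_ne_zero ENNReal.ofNat_ne_top, one_mul]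
  simp_rw [h2 hf, fun n => h2 (hu n)]
  refine le_trans (le_of_eq ?_) (lintegral_liminf_le fun n => by fun_prop)
  refine lintegral_congr fun z => ?_
  refine (Filter.Tendsto.liminf_eq ?_).symm
  refine ENNReal.Tendsto.const_mul ?_ (Or.inr (by simp))
  exact ((ENNReal.continuous_pow 2).tendsto _).comp
    ((continuous_enorm.tendsto _).comp ((h z.2).sub (h z.1)))

end EVariance

/-! ### Averages over translates and convolution. -/

section Translation

variable {F : Type*} [NormedAddCommGroup F] [MeasurableSpace F] [BorelSpace F]

theorem lipschitzWith_integral_add {μ : Measure F} [IsProbabilityMeasure μ] {f : F → ℝ}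
    {L : NNReal} (hf : LipschitzWith L f) {B : ℝ} (hB : ∀ x, ‖f x‖ ≤ B) :
    LipschitzWith L fun y => ∫ x, f (x + y) ∂μ := by
  have hi : ∀ y, Integrable (fun x => f (x + y)) μ := fun y =>
    Integrable.of_bound (hf.continuous.comp (by fun_prop)).aestronglyMeasurable B
      (.of_forall fun x => hB _)
  refine LipschitzWith.of_dist_le_mul fun y z => ?_
  rw [dist_eq_norm, ← integral_sub (hi y) (hi z)]
  have := norm_integral_le_of_norm_le_const (μ := μ) (f := fun x => f (x + y) - f (x + z))
    (C := L * dist y z) (.of_forall fun x => by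
      simpa [dist_eq_norm] using hf.dist_le_mul (x + y) (x + z))
  simpa using this

variable [SecondCountableTopology F]

theorem ae_ae_add_of_ae_conv {μ ν : Measure F} [SFinite μ] [SFinite ν] {p : F → Prop}
    (hp : MeasurableSet {x | p x}) (h : ∀ᵐ z ∂(μ ∗ ν), p z) :
    ∀ᵐ y ∂ν, ∀ᵐ x ∂μ, p (x + y) := by
  have h' : ∀ᵐ z ∂(μ.prod ν), p (z.1 + z.2) := by
    rw [Measure.conv, ae_map_iff (by fun_prop) hp] at h
    exact h
  exact Measure.ae_ae_of_ae_prod (Measure.measurePreserving_swap.quasiMeasurePreserving.ae h')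

theorem integral_conv_eq_integral_prod {G : Type*} [NormedAddCommGroup G] [NormedSpace ℝ G]
    {μ ν : Measure F} {f : F → G} (hf : StronglyMeasurable f) :
    ∫ z, f z ∂(μ ∗ ν) = ∫ p, f (p.1 + p.2) ∂(μ.prod ν) := by
  rw [Measure.conv, integral_map (by fun_prop) hf.aestronglyMeasurable]

theorem integral_conv_eq_integral_integral {μ ν : Measure F} [IsProbabilityMeasure μ]
    [IsProbabilityMeasure ν] {f : F → ℝ} (hf : StronglyMeasurable f) {B : ℝ}
    (hB : ∀ x, ‖f x‖ ≤ B) :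
    ∫ z, f z ∂(μ ∗ ν) = ∫ y, ∫ x, f (x + y) ∂μ ∂ν := by
  rw [integral_conv_eq_integral_prod hf, integral_prod_symm]
  exact Integrable.of_bound (hf.comp_measurable (by fun_prop)).aestronglyMeasurable B
    (.of_forall fun x => hB _)

end Translation

/-! ### Gradients of Lipschitz functions and of their averages. -/

section Gradient

variable {F : Type*} [NormedAddCommGroup F] [InnerProductSpace ℝ F] [CompleteSpace F]

theorem norm_gradient_eq_norm_fderiv (f : F → ℝ) (x : F) : ‖∇ f x‖ = ‖fderiv ℝ f x‖ :=
  LinearIsometryEquiv.norm_map _ _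

theorem norm_gradient_le_of_lipschitzWith {f : F → ℝ} {L : NNReal} (hf : LipschitzWith L f)
    (x : F) : ‖∇ f x‖ ≤ L := by
  rw [norm_gradient_eq_norm_fderiv]
  exact norm_fderiv_le_of_lipschitz ℝ hf

theorem hasGradientAt_comp_const_add {f : F → ℝ} {x y : F} (h : DifferentiableAt ℝ f (x + y)) :
    HasGradientAt (fun z => f (z + y)) (∇ f (x + y)) x := by
  rw [hasGradientAt_iff_hasFDerivAt, toDual_gradient]
  exact h.hasFDerivAt.comp x ((hasFDerivAt_id x).add_const y)

variable [MeasurableSpace F] [BorelSpace F]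

theorem measurable_gradient (f : F → ℝ) : Measurable (∇ f) :=
  (InnerProductSpace.toDual ℝ F).symm.continuous.measurable.comp (measurable_fderiv ℝ f)

variable [SecondCountableTopology F]

theorem stronglyMeasurable_gradient (f : F → ℝ) : StronglyMeasurable (∇ f) :=
  (measurable_gradient f).stronglyMeasurable

theorem memLp_gradient_of_lipschitzWith {μ : Measure F} [IsFiniteMeasure μ] {f : F → ℝ}
    {L : NNReal} (hf : LipschitzWith L f) : MemLp (∇ f) 2 μ :=
  MemLp.of_bound (stronglyMeasurable_gradient f).aestronglyMeasurable L
    (.of_forall (norm_gradient_le_of_lipschitzWith hf))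

/-- Differentiation under the integral: the Lipschitz constant dominates all difference quotients,
so differentiability at x + y is needed only for almost every x. -/
theorem hasGradientAt_integral_add {μ : Measure F} [IsProbabilityMeasure μ] {f : F → ℝ}
    {L : NNReal} (hf : LipschitzWith L f) {B : ℝ} (hB : ∀ x, ‖f x‖ ≤ B) {y : F}
    (hd : ∀ᵐ x ∂μ, DifferentiableAt ℝ f (x + y)) :
    HasGradientAt (fun y => ∫ x, f (x + y) ∂μ) (∫ x, ∇ f (x + y) ∂μ) y := by
  have hm : ∀ y, AEStronglyMeasurable (fun x => f (x + y)) μ := fun y =>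
    (hf.continuous.comp (by fun_prop)).aestronglyMeasurable
  have hfm : AEStronglyMeasurable (fun x => fderiv ℝ f (x + y)) μ := by
    simp_rw [← toDual_gradient]
    exact (InnerProductSpace.toDual ℝ F).continuous.comp_aestronglyMeasurable
      ((measurable_gradient f).comp (by fun_prop)).aestronglyMeasurable
  obtain ⟨h1, h2⟩ := hasFDerivAt_integral_of_dominated_loc_of_lip' (𝕜 := ℝ) (μ := μ)
    (F := fun y x => f (x + y)) (F' := fun x => fderiv ℝ f (x + y)) (x₀ := y) (s := Set.univ)
    (bound := fun _ => L) Filter.univ_mem (fun y _ => hm y)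
    (Integrable.of_bound (hm y) B (.of_forall fun x => hB _))
    hfm
    (.of_forall fun x z _ => by simpa [dist_eq_norm] using hf.dist_le_mul (x + z) (x + y))
    (integrable_const _)
    (hd.mono fun x hx => hx.hasFDerivAt.comp y ((hasFDerivAt_id y).const_add x))
  rw [hasGradientAt_iff_hasFDerivAt]
  have hi : Integrable (fun x => ∇ f (x + y)) μ :=
    Integrable.of_bound ((measurable_gradient f).comp (by fun_prop)).aestronglyMeasurable L
      (.of_forall fun x => norm_gradient_le_of_lipschitzWith hf _)
  convert! h2 using 1
  ext v
  rw [InnerProductSpace.toDual_apply_apply, ContinuousLinearMap.integral_apply h1,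
    real_inner_comm, ← integral_inner hi]
  refine integral_congr_ae (.of_forall fun x => ?_)
  simp only
  rw [real_inner_comm, inner_gradient_left]

/-! ### Poincaré inequalities for a convolution. -/

/-- The Poincaré inequality with real constant `a`, for bounded Lipschitz functions that are
differentiable almost everywhere. -/
def LipschitzPoincare (μ : Measure F) (a : ℝ) : Prop :=
  ∀ (f : F → ℝ) (L : NNReal) (B : ℝ), LipschitzWith L f → (∀ x, ‖f x‖ ≤ B) →
    (∀ᵐ x ∂μ, DifferentiableAt ℝ f x) → Var[f; μ] ≤ a * ∫ x, ‖∇ f x‖ ^ 2 ∂μ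

/-- Conditioning on the second summand: the variance of `f` under a convolution is bounded by
the energy in the first variable and the energy of the averaged gradient in the second. -/
theorem variance_conv_le {μ ν : Measure F} [IsProbabilityMeasure μ] [IsProbabilityMeasure ν]
    {a b : ℝ} (ha : LipschitzPoincare μ a) (hb : LipschitzPoincare ν b)
    {f : F → ℝ} {L : NNReal} (hf : LipschitzWith L f) {B : ℝ} (hB : ∀ x, ‖f x‖ ≤ B)
    (hd : ∀ᵐ z ∂(μ ∗ ν), DifferentiableAt ℝ f z) :
    Var[f; μ ∗ ν] ≤ a * ∫ z, ‖∇ f z‖ ^ 2 ∂(μ ∗ ν) +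
      b * ∫ y, ‖∫ x, ∇ f (x + y) ∂μ‖ ^ 2 ∂ν := by
  -- For almost every y this makes the translate f(· + y) admissible for μ and the average `g`
  -- differentiable at y.
  have hd' := ae_ae_add_of_ae_conv (measurableSet_of_differentiableAt ℝ f) hd
  have hfm : StronglyMeasurable f := hf.continuous.stronglyMeasurable
  have hB0 : 0 ≤ B := (norm_nonneg _).trans (hB 0)
  have hB2 : ∀ x, ‖f x ^ 2‖ ≤ B ^ 2 := fun x => by
    rw [norm_pow]; exact pow_le_pow_left₀ (norm_nonneg _) (hB x) 2
  have hL2 : ∀ x, ‖‖∇ f x‖ ^ 2‖ ≤ (L : ℝ) ^ 2 := fun x => by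
    rw [norm_pow, norm_norm]
    exact pow_le_pow_left₀ (norm_nonneg _) (norm_gradient_le_of_lipschitzWith hf x) 2
  have hmem : ∀ (ρ : Measure F) [IsProbabilityMeasure ρ] {h : F → ℝ}, Continuous h →
      (∀ x, ‖h x‖ ≤ B) → MemLp h 2 ρ := fun ρ _ h hc hh =>
    MemLp.of_bound hc.aestronglyMeasurable B (.of_forall hh)
  set g : F → ℝ := fun y => ∫ x, f (x + y) ∂μ with hg
  have hgL : LipschitzWith L g := lipschitzWith_integral_add hf hB
  have hgB : ∀ y, ‖g y‖ ≤ B := fun y => by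
    simpa using norm_integral_le_of_norm_le_const (μ := μ) (.of_forall fun x => hB (x + y))
  have hgd : ∀ᵐ y ∂ν, HasGradientAt g (∫ x, ∇ f (x + y) ∂μ) y :=
    hd'.mono fun y hy => hasGradientAt_integral_add hf hB hy
  have hVg : Var[g; ν] ≤ b * ∫ y, ‖∫ x, ∇ f (x + y) ∂μ‖ ^ 2 ∂ν := by
    refine (hb g L B hgL hgB (hgd.mono fun y hy => hy.differentiableAt)).trans_eq ?_
    congr 1
    exact integral_congr_ae (hgd.mono fun y hy => by simp only [hy.gradient])
  have hVf : ∀ᵐ y ∂ν, ∫ x, f (x + y) ^ 2 ∂μ - g y ^ 2 ≤ a * ∫ x, ‖∇ f (x + y)‖ ^ 2 ∂μ := by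
    filter_upwards [hd'] with y hy
    have hc : Continuous fun x => f (x + y) := hf.continuous.comp (by fun_prop)
    have hl : LipschitzWith L fun x => f (x + y) :=
      LipschitzWith.of_dist_le_mul fun u v => by simpa using hf.dist_le_mul (u + y) (v + y)
    have h := ha (fun x => f (x + y)) L B hl (fun x => hB _)
      (hy.mono fun x hx => (hasGradientAt_comp_const_add hx).differentiableAt)
    rw [variance_eq_sub (hmem μ hc fun x => hB _)] at h
    refine (show _ = _ from ?_).trans_le (h.trans_eq ?_)
    · rfl
    · congr 1
      exact integral_congr_ae (hy.mono fun x hx => by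
        simp only [(hasGradientAt_comp_const_add hx).gradient])
  have hi1 : Integrable (fun y => ∫ x, f (x + y) ^ 2 ∂μ) ν := by
    have : Integrable (fun p : F × F => f (p.1 + p.2) ^ 2) (μ.prod ν) :=
      Integrable.of_bound ((hf.continuous.comp (by fun_prop)).pow 2).aestronglyMeasurable
        (B ^ 2) (.of_forall fun p => hB2 _)
    exact this.integral_prod_right
  have hi2 : Integrable (fun y => g y ^ 2) ν := (hmem ν hgL.continuous hgB).integrable_sq
  have hi3 : Integrable (fun y => ∫ x, ‖∇ f (x + y)‖ ^ 2 ∂μ) ν := by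
    have : Integrable (fun p : F × F => ‖∇ f (p.1 + p.2)‖ ^ 2) (μ.prod ν) :=
      Integrable.of_bound
        (((measurable_gradient f).comp (by fun_prop)).norm.pow_const 2).aestronglyMeasurable
        ((L : ℝ) ^ 2) (.of_forall fun p => hL2 _)
    exact this.integral_prod_right
  have hint := integral_mono_ae (hi1.sub hi2) (hi3.const_mul a) hVf
  simp only [Pi.sub_apply] at hint
  rw [integral_sub hi1 hi2, integral_const_mul,
    ← integral_conv_eq_integral_integral (f := fun z => f z ^ 2) (hfm.pow 2) hB2,
    ← integral_conv_eq_integral_integral (f := fun z => ‖∇ f z‖ ^ 2) ((stronglyMeasurable_gradient f).norm.pow 2) hL2] at hint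
  rw [variance_eq_sub (hmem ν hgL.continuous hgB), ← integral_conv_eq_integral_integral hfm hB]
    at hVg
  rw [variance_eq_sub (hmem (μ ∗ ν) hf.continuous hB)]
  simp only [Pi.pow_apply] at hVg hint ⊢
  linarith

/-- The improved Poincaré inequality for a convolution, with the deficit controlled by the
variance of the gradient. -/
theorem variance_conv_le_sub {μ ν : Measure F} [IsProbabilityMeasure μ] [IsProbabilityMeasure ν]
    {a b : ℝ} (ha0 : 0 ≤ a) (hb0 : 0 ≤ b)
    (ha : LipschitzPoincare μ a) (hb : LipschitzPoincare ν b)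
    {f : F → ℝ} {L : NNReal} (hf : LipschitzWith L f) {B : ℝ} (hB : ∀ x, ‖f x‖ ≤ B)
    (hd : ∀ᵐ z ∂(μ ∗ ν), DifferentiableAt ℝ f z) :
    Var[f; μ ∗ ν] ≤ (a + b) * ∫ z, ‖∇ f z‖ ^ 2 ∂(μ ∗ ν) -
      a * b / (a + b) * (∫ z, ‖∇ f z‖ ^ 2 ∂(μ ∗ ν) - ‖∫ z, ∇ f z ∂(μ ∗ ν)‖ ^ 2) := by
  have h1 := variance_conv_le ha hb hf hB hd
  have h2 := variance_conv_le hb ha hf hB (by rwa [Measure.conv_comm])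
  rw [Measure.conv_comm ν μ] at h2
  have hes := efronStein_two (μ := μ) (ν := ν) (W := fun p => ∇ f (p.1 + p.2))
    ((stronglyMeasurable_gradient f).comp_measurable (by fun_prop))
    (fun p => norm_gradient_le_of_lipschitzWith hf _)
  rw [← integral_conv_eq_integral_prod (stronglyMeasurable_gradient f),
    ← integral_conv_eq_integral_prod (f := fun z => ‖∇ f z‖ ^ 2)
      ((stronglyMeasurable_gradient f).norm.pow 2)] at hes
  simp_rw [add_comm _ (_ : F)] at h2
  have hV := variance_nonneg f (μ ∗ ν)
  dsimp only at hes
  generalize Var[f; μ ∗ ν] = V at *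
  generalize ∫ z, ‖∇ f z‖ ^ 2 ∂(μ ∗ ν) = G at *
  generalize ‖∫ z, ∇ f z ∂(μ ∗ ν)‖ ^ 2 = M at *
  generalize ∫ y, ‖∫ x, ∇ f (x + y) ∂μ‖ ^ 2 ∂ν = S at *
  generalize ∫ x, ‖∫ y, ∇ f (x + y) ∂ν‖ ^ 2 ∂μ = T at *
  rcases (add_nonneg ha0 hb0).eq_or_lt with h0 | h0
  · obtain rfl : a = 0 := by linarith
    obtain rfl : b = 0 := by linarith
    simpa using h1
  -- Add a times `h1` and b times `h2`: S and T both get the coefficient ab, so `hes` bounds them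
  -- together.
  · have key : V * (a + b) ≤ (a + b) * G * (a + b) - a * b * (G - M) := by
      nlinarith [mul_le_mul_of_nonneg_left h1 ha0, mul_le_mul_of_nonneg_left h2 hb0,
        mul_le_mul_of_nonneg_left hes (mul_nonneg ha0 hb0)]
    rw [div_mul_eq_mul_div, ← sub_nonneg]
    have e : (a + b) * G - a * b * (G - M) / (a + b) - V =
        ((a + b) * G * (a + b) - a * b * (G - M) - V * (a + b)) / (a + b) := by
      field_simp
    rw [e]
    exact div_nonneg (by linarith) h0.le

end Gradient

/-! ### Reduction to bounded Lipschitz test functions. -/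

section Truncation

theorem LocallyLipschitz.exists_lipschitzWith_of_eq_zero_of_bounded {F : Type*}
    [NormedAddCommGroup F] [ProperSpace F] {u : F → ℝ} (hu : LocallyLipschitz u) {R B : ℝ}
    (hR : ∀ x, R ≤ ‖x‖ → u x = 0) (hB : ∀ x, ‖u x‖ ≤ B) : ∃ L, LipschitzWith L u := by
  -- The extra 1 keeps points outside this ball at distance at least 1 from the support, where the
  -- bound B serves as a Lipschitz constant.
  obtain ⟨K, hK⟩ := (hu.locallyLipschitzOn (s := Metric.closedBall 0 (R + 1)))
    |>.exists_lipschitzOnWith_of_compact (isCompact_closedBall 0 (R + 1))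
  have hB0 : 0 ≤ B := (norm_nonneg _).trans (hB 0)
  have far : ∀ x y : F, R + 1 < ‖y‖ → ‖u x - u y‖ ≤ B * ‖x - y‖ := by
    intro x y hy
    rw [hR y (by linarith), sub_zero]
    rcases le_total R ‖x‖ with hx | hx
    · rw [hR x hx, norm_zero]; positivity
    · refine (hB x).trans (le_mul_of_one_le_right hB0 ?_)
      have := norm_sub_norm_le y x
      rw [norm_sub_rev] at this
      linarith
  refine ⟨K + B.toNNReal, LipschitzWith.of_dist_le_mul fun x y => ?_⟩
  have hcoe : ((K + B.toNNReal : NNReal) : ℝ) = K + B := by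
    rw [NNReal.coe_add, Real.coe_toNNReal _ hB0]
  rw [hcoe, dist_eq_norm, dist_eq_norm, add_mul]
  have h0 : 0 ≤ (K : ℝ) * ‖x - y‖ := by positivity
  have h1 : 0 ≤ B * ‖x - y‖ := by positivity
  by_cases hy : R + 1 < ‖y‖
  · linarith [far x y hy]
  by_cases hx : R + 1 < ‖x‖
  · have := far y x hx
    rw [norm_sub_rev, norm_sub_rev y x] at this
    linarith
  · have := hK.dist_le_mul x (by simpa using hx) y (by simpa using hy)
    rw [dist_eq_norm, dist_eq_norm] at this
    linarith

variable {F : Type*} [NormedAddCommGroup F] [InnerProductSpace ℝ F] [FiniteDimensional ℝ F]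

/-- Truncation of the values of `f` at height `ε⁻¹` and of its support at radius of order
`ε⁻²`. -/
noncomputable def smoothTruncation (χ : ContDiffBump (0 : F)) (ε : ℝ) (f : F → ℝ) (x : F) : ℝ :=
  χ (ε ^ 2 • x) * (ε⁻¹ * Real.sin (ε * f x))

theorem norm_inv_mul_sin_le {ε : ℝ} (hε : 0 < ε) (t : ℝ) : ‖ε⁻¹ * Real.sin (ε * t)‖ ≤ ε⁻¹ := by
  rw [norm_mul, Real.norm_of_nonneg (inv_pos.2 hε).le]
  exact mul_le_of_le_one_right (inv_pos.2 hε).le (Real.abs_sin_le_one _)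

theorem norm_contDiffBump_le_one (χ : ContDiffBump (0 : F)) (x : F) : ‖χ x‖ ≤ 1 := by
  rw [Real.norm_of_nonneg χ.nonneg]
  exact χ.le_one

theorem norm_smoothTruncation_le (χ : ContDiffBump (0 : F)) {ε : ℝ} (hε : 0 < ε) (f : F → ℝ) (x : F) :
    ‖smoothTruncation χ ε f x‖ ≤ ε⁻¹ := by
  rw [smoothTruncation, norm_mul]
  exact (mul_le_of_le_one_left (norm_nonneg _) (norm_contDiffBump_le_one χ _)).trans
    (norm_inv_mul_sin_le hε _)

theorem exists_lipschitzWith_smoothTruncation (χ : ContDiffBump (0 : F)) {ε : ℝ} (hε : 0 < ε)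
    {f : F → ℝ} (hf : LocallyLipschitz f) : ∃ L, LipschitzWith L (smoothTruncation χ ε f) := by
  have hH : ContDiff ℝ 1 fun p : F × ℝ => χ (ε ^ 2 • p.1) * (ε⁻¹ * Real.sin (ε * p.2)) := by
    have := χ.contDiff (n := 1)
    fun_prop
  have hl : LocallyLipschitz (smoothTruncation χ ε f) := by
    have h := hH.locallyLipschitz.comp (LocallyLipschitz.id.prodMk hf)
    exact h
  refine hl.exists_lipschitzWith_of_eq_zero_of_bounded (R := χ.rOut / ε ^ 2) (fun x hx => ?_)
    (norm_smoothTruncation_le χ hε f)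
  rw [smoothTruncation, χ.zero_of_le_dist, zero_mul]
  rw [dist_zero_right, norm_smul, Real.norm_of_nonneg (by positivity)]
  rwa [div_le_iff₀' (by positivity)] at hx

theorem differentiableAt_smoothTruncation (χ : ContDiffBump (0 : F)) (ε : ℝ) {f : F → ℝ} {x : F}
    (hf : DifferentiableAt ℝ f x) : DifferentiableAt ℝ (smoothTruncation χ ε f) x := by
  have : Differentiable ℝ χ := (χ.contDiff (n := 1)).differentiable one_ne_zero
  unfold smoothTruncation
  fun_prop

/-- The sine factor has slope at most 1 in f and, unlike clipping, creates no new points of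
non-differentiability. The cutoff has slope O(ε²) against height ε⁻¹, which leaves an error O(ε). -/
theorem norm_gradient_smoothTruncation_le (χ : ContDiffBump (0 : F)) {L : NNReal}
    (hL : LipschitzWith L χ) {ε : ℝ} (hε : 0 < ε) {f : F → ℝ} {x : F}
    (hf : DifferentiableAt ℝ f x) : ‖∇ (smoothTruncation χ ε f) x‖ ≤ ‖∇ f x‖ + L * ε := by
  have hχ : Differentiable ℝ χ := (χ.contDiff (n := 1)).differentiable one_ne_zero
  have h1 : HasFDerivAt (fun x => χ (ε ^ 2 • x)) (fderiv ℝ (fun x => χ (ε ^ 2 • x)) x) x := by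
    have : DifferentiableAt ℝ (fun x => χ (ε ^ 2 • x)) x := by fun_prop
    exact this.hasFDerivAt
  have h2 := ((hf.hasFDerivAt.const_mul ε).sin).const_mul ε⁻¹
  have h3 : ‖fderiv ℝ (fun x => χ (ε ^ 2 • x)) x‖ ≤ L * ε ^ 2 := by
    have hl : LipschitzWith (L * ‖ε ^ 2‖₊) fun x => χ (ε ^ 2 • x) :=
      hL.comp (lipschitzWith_smul (ε ^ 2))
    have := norm_fderiv_le_of_lipschitz ℝ hl (x₀ := x)
    rwa [NNReal.coe_mul, coe_nnnorm, Real.norm_of_nonneg (by positivity)] at this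
  rw [norm_gradient_eq_norm_fderiv, norm_gradient_eq_norm_fderiv]
  have h4 : fderiv ℝ (smoothTruncation χ ε f) x = _ := (h1.mul h2).fderiv
  rw [h4]
  refine (norm_add_le _ _).trans (add_le_add ?_ ?_)
  · have e : χ (ε ^ 2 • x) • ε⁻¹ • Real.cos (ε * f x) • ε • fderiv ℝ f x =
        (χ (ε ^ 2 • x) * Real.cos (ε * f x)) • fderiv ℝ f x := by
      simp only [smul_smul]
      congr 1
      field_simp
    rw [e, norm_smul, norm_mul]
    exact mul_le_of_le_one_left (norm_nonneg _) (mul_le_one₀ (norm_contDiffBump_le_one χ _)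
      (norm_nonneg _) (Real.abs_cos_le_one _))
  · rw [norm_smul]
    calc _ ≤ ε⁻¹ * (L * ε ^ 2) :=
          mul_le_mul (norm_inv_mul_sin_le hε _) h3 (norm_nonneg _) (inv_pos.2 hε).le
      _ = L * ε := by field_simp

theorem tendsto_smoothTruncation (χ : ContDiffBump (0 : F)) {e : ℕ → ℝ} (he : ∀ n, 0 < e n)
    (he0 : Filter.Tendsto e Filter.atTop (nhds 0)) (f : F → ℝ) (x : F) :
    Filter.Tendsto (fun n => smoothTruncation χ (e n) f x) Filter.atTop (nhds (f x)) := by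
  have h1 : Filter.Tendsto (fun n => χ (e n ^ 2 • x)) Filter.atTop (nhds 1) := by
    have hc : Continuous fun t : ℝ => χ (t ^ 2 • x) := χ.continuous.comp (by fun_prop)
    have := (hc.tendsto 0).comp he0
    have h0 : χ (0 : F) = 1 := χ.one_of_mem_closedBall (by simpa using χ.rIn_pos.le)
    simpa [h0, Function.comp_def] using this
  have h2 : Filter.Tendsto (fun n => (e n)⁻¹ * Real.sin (e n * f x)) Filter.atTop
      (nhds (f x)) := by
    have hd : HasDerivAt (fun t => Real.sin (t * f x)) (f x) 0 := by
      simpa using ((hasDerivAt_id (0 : ℝ)).mul_const (f x)).sin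
    have := hd.tendsto_slope_zero.comp (tendsto_nhdsWithin_iff.2
      ⟨he0, .of_forall fun n => (he n).ne'⟩)
    simpa [Function.comp_def] using this
  simpa only [smoothTruncation, one_mul] using h1.mul h2

theorem add_sq_le_weighted {a δ : ℝ} (hδ : 0 ≤ δ) :
    (a + δ) ^ 2 ≤ (1 + δ) * a ^ 2 + (δ ^ 2 + δ) := by
  nlinarith [mul_nonneg hδ (sq_nonneg (a - 1))]

variable [MeasurableSpace F] [BorelSpace F]

/-- A Poincaré inequality for bounded Lipschitz functions extends to all locally Lipschitz
functions. -/
theorem LipschitzPoincare.evariance_le {μ : Measure F} [IsProbabilityMeasure μ] {a : ℝ}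
    (ha : 0 < a) (h : LipschitzPoincare μ a) {f : F → ℝ} (hf : LocallyLipschitz f)
    (hd : ∀ᵐ x ∂μ, DifferentiableAt ℝ f x) :
    evariance f μ ≤ ENNReal.ofReal a * ∫⁻ x, ‖∇ f x‖ₑ ^ 2 ∂μ := by
  have hF : ProperSpace F := FiniteDimensional.proper_real F
  by_cases hG : ∫⁻ x, ‖∇ f x‖ₑ ^ 2 ∂μ = ∞
  -- Positivity of a matters here: 0 · ∞ = 0 in `ℝ≥0∞`.
  · rw [hG, ENNReal.mul_top (by simpa using ha)]
    exact le_top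
  let χ : ContDiffBump (0 : F) := default
  obtain ⟨L, hL⟩ := ContDiff.lipschitzWith_of_hasCompactSupport χ.hasCompactSupport
    (χ.contDiff (n := 1)) one_ne_zero
  let e : ℕ → ℝ := fun n => 1 / ((n : ℝ) + 1)
  have he : ∀ n, 0 < e n := fun n => Nat.one_div_pos_of_nat
  have he0 : Filter.Tendsto e Filter.atTop (nhds 0) := tendsto_one_div_add_atTop_nhds_zero_nat
  set G := ∫⁻ x, ‖∇ f x‖ₑ ^ 2 ∂μ with hGdef
  let r : ℝ → ℝ≥0∞ := fun t => ENNReal.ofReal a *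
    (ENNReal.ofReal (1 + t) * G + ENNReal.ofReal (t ^ 2 + t))
  have hbound : ∀ n, evariance (smoothTruncation χ (e n) f) μ ≤ r (L * e n) := by
    intro n
    obtain ⟨K, hK⟩ := exists_lipschitzWith_smoothTruncation χ (he n) hf
    have hδ : 0 ≤ (L : ℝ) * e n := mul_nonneg L.2 (he n).le
    have hp := h _ K _ hK (norm_smoothTruncation_le χ (he n) f)
      (hd.mono fun x hx => differentiableAt_smoothTruncation χ (e n) hx)
    have hm : MemLp (smoothTruncation χ (e n) f) 2 μ :=
      MemLp.of_bound hK.continuous.aestronglyMeasurable _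
        (.of_forall (norm_smoothTruncation_le χ (he n) f))
    rw [← ofReal_variance hm]
    refine (ENNReal.ofReal_le_ofReal hp).trans ?_
    rw [ENNReal.ofReal_mul ha.le]
    refine mul_le_mul_right ?_ _
    rw [ofReal_integral_eq_lintegral_ofReal
      (integrable_norm_sq_of_memLp (memLp_gradient_of_lipschitzWith hK))
      (.of_forall fun _ => by positivity), hGdef,
      ← lintegral_const_mul _ ((measurable_gradient f).enorm.pow_const 2)]
    have hone : ENNReal.ofReal ((L * e n) ^ 2 + L * e n) =
        ∫⁻ _, ENNReal.ofReal ((L * e n) ^ 2 + L * e n) ∂μ := by simp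
    rw [hone, ← lintegral_add_right _ measurable_const]
    refine lintegral_mono_ae (hd.mono fun x hx => ?_)
    rw [← ofReal_norm, ← ENNReal.ofReal_pow (norm_nonneg _), ← ENNReal.ofReal_mul (by linarith),
      ← ENNReal.ofReal_add (by positivity) (by positivity)]
    refine ENNReal.ofReal_le_ofReal (le_trans ?_ (add_sq_le_weighted hδ))
    exact pow_le_pow_left₀ (norm_nonneg _) (norm_gradient_smoothTruncation_le χ hL (he n) hx) 2
  have hlim : Filter.Tendsto (fun n => r (L * e n)) Filter.atTop (nhds (ENNReal.ofReal a * G)) := by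
    have hr : Filter.Tendsto r (nhds 0) (nhds (r 0)) := by
      refine ENNReal.Tendsto.const_mul (Filter.Tendsto.add ?_ ?_) (Or.inr ENNReal.ofReal_ne_top)
      · exact ENNReal.Tendsto.mul_const
          (ENNReal.tendsto_ofReal ((by fun_prop : Continuous fun t : ℝ => 1 + t).tendsto 0))
          (Or.inr hG)
      · exact ENNReal.tendsto_ofReal ((by fun_prop : Continuous fun t : ℝ => t ^ 2 + t).tendsto 0)
    have hr0 : r 0 = ENNReal.ofReal a * G := by simp [r]
    rw [hr0] at hr
    refine hr.comp ?_
    simpa using he0.const_mul (L : ℝ)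
  calc evariance f μ
      ≤ Filter.liminf (fun n => evariance (smoothTruncation χ (e n) f) μ) Filter.atTop :=
        evariance_le_liminf
          (fun n => by
            obtain ⟨K, hK⟩ := exists_lipschitzWith_smoothTruncation χ (he n) hf
            exact hK.continuous.measurable)
          hf.continuous.measurable (tendsto_smoothTruncation χ he he0 f)
    _ ≤ Filter.liminf (fun n => r (L * e n)) Filter.atTop :=
        Filter.liminf_le_liminf (.of_forall hbound)
    _ = ENNReal.ofReal a * G := hlim.liminf_eq

end Truncation

/-! ### The Poincaré constant as an optimal constant. -/

section PoincareConstant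

variable {d : ℕ} {μ ν : Measure (EuclideanSpace ℝ (Fin d))}

/-- Dividing by the energy shows that the infimum is itself admissible. Zero energy is treated
apart, and finite energy is assumed because the constant may be 0. -/
theorem evariance_le_poincareConst_mul (hμ : poincareConst μ ≠ ∞)
    {f : EuclideanSpace ℝ (Fin d) → ℝ} (hf : LocallyLipschitz f)
    (hd : ∀ᵐ x ∂μ, DifferentiableAt ℝ f x) (hG : ∫⁻ x, ‖∇ f x‖ₑ ^ 2 ∂μ ≠ ∞) :
    evariance f μ ≤ poincareConst μ * ∫⁻ x, ‖∇ f x‖ₑ ^ 2 ∂μ := by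
  have hS : ∃ C, SatisfiesPoincare μ C := by
    by_contra! h
    exact hμ (by simp [poincareConst, h])
  by_cases h0 : ∫⁻ x, ‖∇ f x‖ₑ ^ 2 ∂μ = 0
  · obtain ⟨C, hC⟩ := hS
    simpa [h0] using hC f hf hd
  · rw [← ENNReal.div_le_iff h0 hG]
    exact le_sInf fun C hC => (ENNReal.div_le_iff h0 hG).2 (hC f hf hd)

theorem variance_le_poincareConst_toReal_mul [IsProbabilityMeasure μ]
    (hμ : poincareConst μ ≠ ∞) {f : EuclideanSpace ℝ (Fin d) → ℝ} (hf : LocallyLipschitz f)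
    (hd : ∀ᵐ x ∂μ, DifferentiableAt ℝ f x) (hG : MemLp (∇ f) 2 μ) :
    MemLp f 2 μ ∧ Var[f; μ] ≤ (poincareConst μ).toReal * ∫ x, ‖∇ f x‖ ^ 2 ∂μ := by
  have e : ∫⁻ x, ‖∇ f x‖ₑ ^ 2 ∂μ = ENNReal.ofReal (∫ x, ‖∇ f x‖ ^ 2 ∂μ) := by
    rw [ofReal_integral_eq_lintegral_ofReal (integrable_norm_sq_of_memLp hG)
      (.of_forall fun _ => by positivity)]
    refine lintegral_congr fun x => ?_
    rw [ENNReal.ofReal_pow (norm_nonneg _), ofReal_norm]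
  have h := evariance_le_poincareConst_mul hμ hf hd (e ▸ ENNReal.ofReal_ne_top)
  rw [e] at h
  have hm : MemLp f 2 μ := (evariance_lt_top_iff_memLp hf.continuous.aestronglyMeasurable).1
    (h.trans_lt (ENNReal.mul_lt_top hμ.lt_top ENNReal.ofReal_lt_top))
  refine ⟨hm, ?_⟩
  have := ENNReal.toReal_mono (ENNReal.mul_ne_top hμ ENNReal.ofReal_ne_top) h
  rwa [ENNReal.toReal_mul,
    ENNReal.toReal_ofReal (integral_nonneg fun _ => by positivity)] at this

theorem lipschitzPoincare_poincareConst [IsProbabilityMeasure μ] (hμ : poincareConst μ ≠ ∞) :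
    LipschitzPoincare μ (poincareConst μ).toReal := fun _ _ _ hf _ hd =>
  (variance_le_poincareConst_toReal_mul hμ hf.locallyLipschitz hd
    (memLp_gradient_of_lipschitzWith hf)).2

theorem LipschitzPoincare.poincareConst_le [IsProbabilityMeasure μ] {a : ℝ} (ha : 0 ≤ a)
    (h : LipschitzPoincare μ a) : poincareConst μ ≤ ENNReal.ofReal a := by
  -- The slack ε makes the constant positive, as `LipschitzPoincare.evariance_le` requires.
  refine ENNReal.le_of_forall_pos_le_add fun ε hε _ => sInf_le ?_
  have h' : LipschitzPoincare μ (a + ε) := fun f L B hf hB hd =>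
    (h f L B hf hB hd).trans (mul_le_mul_of_nonneg_right (by simp)
      (integral_nonneg fun _ => by positivity))
  intro f hf hd
  have hε' : (0 : ℝ) < ε := hε
  have := h'.evariance_le (by linarith) hf hd
  rwa [ENNReal.ofReal_add ha hε'.le, ENNReal.ofReal_coe_nnreal] at this

theorem LipschitzPoincare.conv [IsProbabilityMeasure μ] [IsProbabilityMeasure ν] {a b : ℝ}
    (ha0 : 0 ≤ a) (hb0 : 0 ≤ b) (ha : LipschitzPoincare μ a) (hb : LipschitzPoincare ν b) :
    LipschitzPoincare (μ ∗ ν) (a + b) := by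
  intro f L B hf hB hd
  have h := variance_conv_le_sub ha0 hb0 ha hb hf hB hd
  have hG : ‖∫ z, ∇ f z ∂(μ ∗ ν)‖ ^ 2 ≤ ∫ z, ‖∇ f z‖ ^ 2 ∂(μ ∗ ν) :=
    norm_integral_sq_le (memLp_gradient_of_lipschitzWith hf)
  have : 0 ≤ a * b / (a + b) *
      (∫ z, ‖∇ f z‖ ^ 2 ∂(μ ∗ ν) - ‖∫ z, ∇ f z ∂(μ ∗ ν)‖ ^ 2) :=
    mul_nonneg (by positivity) (by linarith)
  linarith

/-! ### Linear test functions and the mean gradient. -/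

theorem hasGradientAt_inner_left {F : Type*} [NormedAddCommGroup F] [InnerProductSpace ℝ F]
    [CompleteSpace F] (v x : F) : HasGradientAt (fun x => ⟪v, x⟫_ℝ) v x := by
  rw [hasGradientAt_iff_hasFDerivAt]
  exact (InnerProductSpace.toDual ℝ F v).hasFDerivAt

theorem lipschitzWith_inner_left {F : Type*} [NormedAddCommGroup F] [InnerProductSpace ℝ F]
    [CompleteSpace F] (v : F) : ∃ L, LipschitzWith L fun x => ⟪v, x⟫_ℝ :=
  ⟨_, (InnerProductSpace.toDual ℝ F v).lipschitz⟩

theorem maxDirVariance_le_poincareConst [IsProbabilityMeasure μ] (hμ : poincareConst μ ≠ ∞) :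
    maxDirVariance μ ≤ poincareConst μ := by
  refine iSup₂_le fun α hα => ?_
  obtain ⟨L, hL⟩ := lipschitzWith_inner_left α
  have hα' : ‖α‖ₑ = 1 := by
    rw [← ofReal_norm, mem_sphere_zero_iff_norm.1 hα, ENNReal.ofReal_one]
  have e : ∫⁻ x, ‖∇ (fun x => ⟪α, x⟫_ℝ) x‖ₑ ^ 2 ∂μ = 1 := by
    simp [(hasGradientAt_inner_left α _).gradient, hα']
  have := evariance_le_poincareConst_mul hμ hL.locallyLipschitz
    (.of_forall fun x => (hasGradientAt_inner_left α x).differentiableAt) (by simp [e])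
  rwa [e, mul_one] at this

theorem variance_inner_le_maxDirVariance [IsProbabilityMeasure μ] (hσ : maxDirVariance μ ≠ ∞)
    (v : EuclideanSpace ℝ (Fin d)) :
    Var[fun x => ⟪v, x⟫_ℝ; μ] ≤ (maxDirVariance μ).toReal * ‖v‖ ^ 2 := by
  rcases eq_or_ne v 0 with rfl | hv
  · simp only [inner_zero_left]
    exact (variance_zero μ).le.trans (by positivity)
  have hv0 : ‖v‖ ≠ 0 := norm_ne_zero_iff.2 hv
  set α := ‖v‖⁻¹ • v with hα
  have hα1 : α ∈ Metric.sphere (0 : EuclideanSpace ℝ (Fin d)) 1 := by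
    rw [mem_sphere_zero_iff_norm, hα, norm_smul, norm_inv, norm_norm, inv_mul_cancel₀ hv0]
  have hle : Var[fun x => ⟪α, x⟫_ℝ; μ] ≤ (maxDirVariance μ).toReal :=
    ENNReal.toReal_mono hσ (le_iSup₂ (f := fun α (_ : α ∈ Metric.sphere
      (0 : EuclideanSpace ℝ (Fin d)) 1) => evariance (fun x => ⟪α, x⟫_ℝ) μ) α hα1)
  have e : (fun x => ⟪v, x⟫_ℝ) = fun x => ‖v‖ * ⟪α, x⟫_ℝ := by
    ext x
    rw [hα, real_inner_smul_left, mul_inv_cancel_left₀ hv0]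
  rw [e, variance_const_mul, mul_comm]
  exact mul_le_mul_of_nonneg_right hle (by positivity)

theorem variance_add_const_mul [IsProbabilityMeasure μ] {X Y : EuclideanSpace ℝ (Fin d) → ℝ}
    (hX : MemLp X 2 μ) (hY : MemLp Y 2 μ) (t : ℝ) :
    Var[fun x => X x + t * Y x; μ] = Var[Y; μ] * (t * t) + 2 * cov[X, Y; μ] * t + Var[X; μ] := by
  rw [variance_fun_add hX (hY.const_mul t), variance_const_mul, covariance_const_mul_right]
  ring

/-- The mean gradient of a near-extremal function is small when the directional variances are
small compared with the Poincaré constant. -/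
theorem norm_integral_gradient_sq_le [IsProbabilityMeasure μ] (hμ : poincareConst μ ≠ ∞)
    {f : EuclideanSpace ℝ (Fin d) → ℝ} {L : NNReal} (hf : LipschitzWith L f)
    (hd : ∀ᵐ x ∂μ, DifferentiableAt ℝ f x) {η : ℝ}
    (hV : ((poincareConst μ).toReal - η) * ∫ x, ‖∇ f x‖ ^ 2 ∂μ ≤ Var[f; μ]) :
    (poincareConst μ).toReal * ‖∫ x, ∇ f x ∂μ‖ ^ 2 ≤
      (∫ x, ‖∇ f x‖ ^ 2 ∂μ) * (√η + √(maxDirVariance μ).toReal) ^ 2 := by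
  have hσ : maxDirVariance μ ≠ ∞ := ne_top_of_le_ne_top hμ (maxDirVariance_le_poincareConst hμ)
  set C := (poincareConst μ).toReal with hC
  have hC0 : 0 ≤ C := ENNReal.toReal_nonneg
  set s := (maxDirVariance μ).toReal with hs
  have hs0 : 0 ≤ s := ENNReal.toReal_nonneg
  have hfG := memLp_gradient_of_lipschitzWith (μ := μ) hf
  obtain ⟨hfm, hfV⟩ := variance_le_poincareConst_toReal_mul hμ hf.locallyLipschitz hd hfG
  set v := ∫ x, ∇ f x ∂μ with hv
  set G := ∫ x, ‖∇ f x‖ ^ 2 ∂μ with hG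
  have hG0 : 0 ≤ G := integral_nonneg fun _ => by positivity
  obtain ⟨M, hM⟩ := lipschitzWith_inner_left v
  have hgr := hasGradientAt_inner_left v
  have hhm : MemLp (fun x => ⟪v, x⟫_ℝ) 2 μ :=
    (variance_le_poincareConst_toReal_mul hμ hM.locallyLipschitz
      (.of_forall fun x => (hgr x).differentiableAt) (memLp_gradient_of_lipschitzWith hM)).1
  have hhV := variance_inner_le_maxDirVariance hσ v
  set c := cov[f, fun x => ⟪v, x⟫_ℝ; μ] with hc
  set H := Var[fun x => ⟪v, x⟫_ℝ; μ] with hH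
  have hH0 : 0 ≤ H := variance_nonneg _ _
  have hvar : ∀ t : ℝ, Var[fun x => f x + t * ⟪v, x⟫_ℝ; μ] =
      H * (t * t) + 2 * c * t + Var[f; μ] := variance_add_const_mul hfm hhm
  have h1 : (2 * c) ^ 2 - 4 * H * Var[f; μ] ≤ 0 :=
    discrim_le_zero fun t => hvar t ▸ variance_nonneg _ _
  -- The deficit C∫|∇·|² − Var of f + t⟨v, ·⟩ is a nonnegative quadratic in t. Its cross term
  -- contains C‖v‖² because v is the mean gradient.
  have h2 : (2 * (C * ‖v‖ ^ 2 - c)) ^ 2 - 4 * (C * ‖v‖ ^ 2 - H) * (C * G - Var[f; μ]) ≤ 0 := by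
    refine discrim_le_zero fun t => ?_
    have hl : LipschitzWith (L + ‖t‖₊ * M) fun x => f x + t * ⟪v, x⟫_ℝ :=
      hf.add ((lipschitzWith_smul t).comp hM)
    have hgrad : ∀ᵐ x ∂μ, HasGradientAt (fun x => f x + t * ⟪v, x⟫_ℝ) (∇ f x + t • v) x := by
      filter_upwards [hd] with x hx
      have h := hx.hasFDerivAt.add ((hgr x).hasFDerivAt.const_mul t)
      rw [hasGradientAt_iff_hasFDerivAt, map_add, toDual_gradient, map_smulₛₗ]
      exact h
    have h := (variance_le_poincareConst_toReal_mul hμ hl.locallyLipschitz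
      (hgrad.mono fun x hx => hx.differentiableAt) (memLp_gradient_of_lipschitzWith hl)).2
    have e : ∫ x, ‖∇ (fun x => f x + t * ⟪v, x⟫_ℝ) x‖ ^ 2 ∂μ =
        G + 2 * t * ‖v‖ ^ 2 + t ^ 2 * ‖v‖ ^ 2 := by
      have e1 : ∫ x, ‖∇ (fun x => f x + t * ⟪v, x⟫_ℝ) x‖ ^ 2 ∂μ =
          ∫ x, ‖∇ f x - (-t) • v‖ ^ 2 ∂μ :=
        integral_congr_ae (hgrad.mono fun x hx => by simp only [hx.gradient]; simp)
      rw [e1, integral_norm_sub_const_sq hfG, ← hv, real_inner_smul_left,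
        real_inner_self_eq_norm_sq, norm_smul, mul_pow, norm_neg, Real.norm_eq_abs, sq_abs]
      ring
    rw [hvar, e, ← hC] at h
    linarith
  have hn0 : 0 ≤ ‖v‖ ^ 2 := by positivity
  have hV0 : 0 ≤ Var[f; μ] := variance_nonneg _ _
  generalize ‖v‖ ^ 2 = n at *
  generalize Var[f; μ] = V at *
  have h3 : |c| ≤ √(C * n * G) * √s := by
    rw [← Real.sqrt_mul (by positivity)]
    refine Real.abs_le_sqrt ?_
    have := mul_le_mul hhV hfV hV0 (by positivity : 0 ≤ s * n)
    nlinarith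
  have h4 : |C * n - c| ≤ √(C * n * G) * √η := by
    rw [← Real.sqrt_mul (by positivity)]
    refine Real.abs_le_sqrt ?_
    have : (C * n - H) * (C * G - V) ≤ C * n * (η * G) :=
      mul_le_mul (by linarith) (by linarith) (by linarith) (by positivity)
    nlinarith
  -- Split Cn = c + (Cn − c): `h3` controls the covariance and `h4` the deficit pairing.
  have h5 : C * n ≤ √(C * n * G) * (√η + √s) := by
    have := le_abs_self c
    have := le_abs_self (C * n - c)
    linarith
  rcases (mul_nonneg hC0 hn0).eq_or_lt with h0 | h0
  · rw [← h0]; positivity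
  · have h6 : (C * n) ^ 2 ≤ (C * n) * (G * (√η + √s) ^ 2) := by
      calc (C * n) ^ 2 ≤ (√(C * n * G) * (√η + √s)) ^ 2 := pow_le_pow_left₀ h0.le h5 2
        _ = _ := by rw [mul_pow, Real.sq_sqrt (by positivity)]; ring
    rw [sq] at h6
    exact le_of_mul_le_mul_left h6 h0

/-! ### Near-extremal functions and the improved bound. -/

theorem exists_nearExtremal [IsProbabilityMeasure μ] {a : ℝ} (ha : 0 ≤ a)
    (h : ENNReal.ofReal a < poincareConst μ) :
    ∃ (f : EuclideanSpace ℝ (Fin d) → ℝ) (L : NNReal) (B : ℝ), LipschitzWith L f ∧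
      (∀ x, ‖f x‖ ≤ B) ∧ (∀ᵐ x ∂μ, DifferentiableAt ℝ f x) ∧
      a * ∫ x, ‖∇ f x‖ ^ 2 ∂μ < Var[f; μ] := by
  by_contra! hcon
  exact h.not_ge (LipschitzPoincare.poincareConst_le ha
    fun f L B hf hB hd => hcon f L B hf hB hd)

theorem poincareConst_conv_ne_top [IsProbabilityMeasure μ] [IsProbabilityMeasure ν]
    (hμ : poincareConst μ ≠ ∞) (hν : poincareConst ν ≠ ∞) : poincareConst (μ ∗ ν) ≠ ∞ :=
  ne_top_of_le_ne_top ENNReal.ofReal_ne_top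
    (((lipschitzPoincare_poincareConst hμ).conv ENNReal.toReal_nonneg ENNReal.toReal_nonneg
      (lipschitzPoincare_poincareConst hν)).poincareConst_le
        (add_nonneg ENNReal.toReal_nonneg ENNReal.toReal_nonneg))

/-- A sharper form of the improved subadditivity of the Poincaré constant. -/
theorem poincareConst_conv_le_sub [IsProbabilityMeasure μ] [IsProbabilityMeasure ν]
    (hμ : poincareConst μ ≠ ∞) (hν : poincareConst ν ≠ ∞)
    (hpos : 0 < (poincareConst (μ ∗ ν)).toReal) :
    (poincareConst (μ ∗ ν)).toReal ≤ (poincareConst μ).toReal + (poincareConst ν).toReal -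
      (poincareConst μ).toReal * (poincareConst ν).toReal /
        ((poincareConst μ).toReal + (poincareConst ν).toReal) *
      (1 - (maxDirVariance (μ ∗ ν)).toReal / (poincareConst (μ ∗ ν)).toReal) := by
  have hfin := poincareConst_conv_ne_top hμ hν
  have ha := lipschitzPoincare_poincareConst hμ
  have hb := lipschitzPoincare_poincareConst hν
  have ha0 : 0 ≤ (poincareConst μ).toReal := ENNReal.toReal_nonneg
  have hb0 : 0 ≤ (poincareConst ν).toReal := ENNReal.toReal_nonneg
  have hs0 : 0 ≤ (maxDirVariance (μ ∗ ν)).toReal := ENNReal.toReal_nonneg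
  have hmean := fun {f : EuclideanSpace ℝ (Fin d) → ℝ} {L : NNReal} (hf : LipschitzWith L f) =>
    norm_integral_gradient_sq_le hfin hf
  have hex := fun a h0 => exists_nearExtremal (μ := μ ∗ ν) (a := a) h0
  have hle := lipschitzPoincare_poincareConst hfin
  have hlt : ∀ x : ℝ, 0 ≤ x → x < (poincareConst (μ ∗ ν)).toReal →
      ENNReal.ofReal x < poincareConst (μ ∗ ν) := fun x hx0 hx =>
    (ENNReal.ofReal_lt_iff_lt_toReal hx0 hfin).2 hx
  generalize (poincareConst μ).toReal = a at *
  generalize (poincareConst ν).toReal = b at *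
  generalize (maxDirVariance (μ ∗ ν)).toReal = s at *
  generalize (poincareConst (μ ∗ ν)).toReal = C at *
  have hK0 : 0 ≤ a * b / (a + b) := by positivity
  have hsub := fun {f : EuclideanSpace ℝ (Fin d) → ℝ} {L : NNReal} {B : ℝ}
      (hf : LipschitzWith L f) (hB : ∀ x, ‖f x‖ ≤ B) =>
    variance_conv_le_sub ha0 hb0 ha hb hf hB
  generalize a * b / (a + b) = K at *
  -- Extremals need not exist, so the bound is proved for functions within η of optimal and η is
  -- then sent to 0.
  have key : ∀ η : ℝ, 0 < η → η < C → C - η ≤ a + b - K * (1 - (√η + √s) ^ 2 / C) := by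
    intro η hη hηC
    obtain ⟨f, L, B, hf, hB, hd, hV⟩ := hex (C - η) (by linarith) (hlt _ (by linarith) (by linarith))
    have h1 := hmean hf hd hV.le
    have h2 := hsub hf hB hd
    have h3 := hle f L B hf hB hd
    have hG0 : 0 ≤ ∫ z, ‖∇ f z‖ ^ 2 ∂(μ ∗ ν) := integral_nonneg fun _ => by positivity
    generalize ∫ z, ‖∇ f z‖ ^ 2 ∂(μ ∗ ν) = G at *
    generalize ‖∫ z, ∇ f z ∂(μ ∗ ν)‖ ^ 2 = n at *
    -- With zero energy, `hV` would force a positive variance while `h3` forces it to vanish.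
    have hG : 0 < G := by
      refine hG0.lt_of_ne fun h => ?_
      rw [← h, mul_zero] at hV h3
      exact absurd hV h3.not_gt
    have h4 : n ≤ G * ((√η + √s) ^ 2 / C) := by
      rw [← mul_div_assoc, le_div_iff₀ hpos]
      linarith
    have h5 := mul_le_mul_of_nonneg_left h4 hK0
    refine le_of_mul_le_mul_right ?_ hG
    nlinarith
  have hc : Continuous fun η : ℝ => a + b - K * (1 - (√η + √s) ^ 2 / C) + η := by fun_prop
  have hlim := (hc.tendsto 0).mono_left (nhdsWithin_le_nhds (s := Set.Ioi 0))
  have := ge_of_tendsto (b := C) hlim (by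
    filter_upwards [Ioo_mem_nhdsGT hpos] with η hη
    linarith [key η hη.1 hη.2])
  simpa [Real.sq_sqrt hs0] using this

theorem sq_div_le_one_sub_div {C s : ℝ} (hC : 0 < C) (hs : 0 ≤ s) (hsC : s ≤ C) :
    (C - s) ^ 2 / ((C - s) ^ 2 + C * s) ≤ 1 - s / C := by
  have hden : 0 < (C - s) ^ 2 + C * s := by
    rcases hs.eq_or_lt with rfl | h
    · simpa using pow_pos hC 2
    · positivity
  rw [one_sub_div hC.ne', div_le_div_iff₀ hden hC]
  nlinarith [mul_nonneg (sub_nonneg.2 hsC) (sq_nonneg s)]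

end PoincareConstant

theorem mainTheorem6 (d : ℕ) (μ ν : Measure (EuclideanSpace ℝ (Fin d)))
    [IsProbabilityMeasure μ] [IsProbabilityMeasure ν]
    (hμ : poincareConst μ ≠ ∞) (hν : poincareConst ν ≠ ∞) :
    poincareConst (μ ∗ ν) ≠ ∞ ∧ maxDirVariance (μ ∗ ν) ≠ ∞ ∧
    (let Cμ : ℝ := (poincareConst μ).toReal
     let Cν : ℝ := (poincareConst ν).toReal
     let C : ℝ := (poincareConst (μ ∗ ν)).toReal
     let σ2 : ℝ := (maxDirVariance (μ ∗ ν)).toReal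
     C ≤ (Cμ + Cν) - Cμ * Cν / (Cμ + Cν) * ((C - σ2) ^ 2 / ((C - σ2) ^ 2 + C * σ2))) := by
  have hfin := poincareConst_conv_ne_top hμ hν
  have hσ := maxDirVariance_le_poincareConst hfin
  refine ⟨hfin, ne_top_of_le_ne_top hfin hσ, ?_⟩
  intro Cμ Cν C σ2
  have ha0 : 0 ≤ Cμ := ENNReal.toReal_nonneg
  have hb0 : 0 ≤ Cν := ENNReal.toReal_nonneg
  have hs0 : 0 ≤ σ2 := ENNReal.toReal_nonneg
  have hsC : σ2 ≤ C := ENNReal.toReal_mono hfin hσ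
  -- If C = 0 then σ² = 0 and the last quotient is 0/0, which evaluates to 0.
  rcases (ENNReal.toReal_nonneg : 0 ≤ C).eq_or_lt with h0 | h0
  · have hs : σ2 = 0 := le_antisymm (h0 ▸ hsC) hs0
    have hC : C = 0 := h0.symm
    rw [hs, hC]
    simpa using add_nonneg ha0 hb0
  · have h1 := poincareConst_conv_le_sub hμ hν h0
    have h2 := mul_le_mul_of_nonneg_left (sq_div_le_one_sub_div h0 hs0 hsC)
      (by positivity : 0 ≤ Cμ * Cν / (Cμ + Cν))
    exact h1.trans (sub_le_sub_left h2 _)
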